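/- Let $\mathbb H$ be the algebra of quaternions, $\mathbb S=\{I\in\mathbb H: I^2=-1\}$, and, for $I\in\mathbb S$, let $\pi(z,I)=\operatorname{Re}z+I\operatorname{Im}z$ for $z\in\mathbb C$ and $\pi(w_0+\sqrt{-1}\,w_1,I)=w_0+Iw_1$ for $w_0+\sqrt{-1}\,w_1\in\mathbb C\otimes_{\mathbb R}\mathbb H$. Let $\mathcal U\subseteq\mathbb C$ be an open set invariant under complex conjugation and let $U=\pi(\mathcal U\times\mathbb S)\subseteq\mathbb H$. A function $f:U\to\mathbb H$ is called slice regular if there is a holomorphic function $F:\mathcal U\to\mathbb C\otimes_{\mathbb R}\mathbb H\cong\mathbb C^4$ with $F(\overline z)=\overline{F(z)}$ (where $\overline{w_0+\sqrt{-1}\,w_1}=w_0-\sqrt{-1}\,w_1$) such that $f(\pi(z,I))=\pi(F(z),I)$ for all $z\in\mathcal U$ and $I\in\mathbb S$. If $f:U\to\mathbb H$ is slice regular and injective, then $f$ is real differentiable at every point $q\in U$ and its real differential $Df_q:\mathbb H\to\mathbb H$ is invertible. -/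

import Mathlib

open scoped Quaternion TensorProduct ComplexConjugate

noncomputable section

namespace SliceRegular

/-- The sphere of quaternionic imaginary units. -/
def imagUnits : Set ℍ[ℝ] := {I | I ^ 2 = -1}

/-- The map `π : ℂ × 𝕊 → ℍ`, `π (z, I) = Re z + I Im z`, real linear in `z`. -/
def piC (I : ℍ[ℝ]) : ℂ →ₗ[ℝ] ℍ[ℝ] where
  toFun z := (z.re : ℍ[ℝ]) + I * (z.im : ℍ[ℝ])
  map_add' z w := by
    simp only [Complex.add_re, Complex.add_im, Quaternion.coe_add, mul_add]
    abel
  map_smul' r z := by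
    rw [RingHom.id_apply, smul_add, ← mul_smul_comm]
    simp [Quaternion.smul_coe]

/-- The map `π : (ℂ ⊗ ℍ) × 𝕊 → ℍ`, real linear in the first variable and determined by
`π (z ⊗ q, I) = π (z, I) q`; thus `π (w₀ + √-1 w₁, I) = w₀ + I w₁`. -/
def piT (I : ℍ[ℝ]) : ℂ ⊗[ℝ] ℍ[ℝ] →ₗ[ℝ] ℍ[ℝ] :=
  TensorProduct.lift ((LinearMap.mul ℝ ℍ[ℝ]).comp (piC I))

/-- The complex conjugation of `ℂ ⊗ ℍ`, determined by `z ⊗ q ↦ conj z ⊗ q`. -/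
def conjT : ℂ ⊗[ℝ] ℍ[ℝ] →ₗ[ℝ] ℂ ⊗[ℝ] ℍ[ℝ] :=
  TensorProduct.map Complex.conjAe.toLinearMap LinearMap.id

/-- The standard basis `1, i, j, k` of `ℍ`. -/
def stdBasis : Module.Basis (Fin 4) ℝ ℍ[ℝ] :=
  QuaternionAlgebra.basisOneIJK (-1 : ℝ) 0 (-1)

/-- The complex linear identification `ℂ ⊗ ℍ ≃ ℂ⁴` given by the standard basis `1, i, j, k`
of `ℍ`, where `ℂ` acts on the left factor of `ℂ ⊗ ℍ`. -/
def toC4 : ℂ ⊗[ℝ] ℍ[ℝ] ≃ₗ[ℂ] (Fin 4 → ℂ) :=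
  (Algebra.TensorProduct.basis ℂ stdBasis).equivFun

/-- The subset `U = π (𝒰 × 𝕊)` of `ℍ`. -/
def circularSet (𝒰 : Set ℂ) : Set ℍ[ℝ] := {q | ∃ z ∈ 𝒰, ∃ I ∈ imagUnits, piC I z = q}

/-- `F` is a stem function on `𝒰`: the set `𝒰` is invariant under conjugation and
`F (conj z)` is the conjugate of `F z` for `z` in `𝒰`. -/
def IsStem (𝒰 : Set ℂ) (F : ℂ → ℂ ⊗[ℝ] ℍ[ℝ]) : Prop :=
  ∀ z ∈ 𝒰, conj z ∈ 𝒰 ∧ F (conj z) = conjT (F z)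

/-- `F : 𝒰 → ℂ ⊗ ℍ ≃ ℂ⁴` is holomorphic (for `𝒰` open). -/
def IsHolomorphicOn (𝒰 : Set ℂ) (F : ℂ → ℂ ⊗[ℝ] ℍ[ℝ]) : Prop :=
  DifferentiableOn ℂ (fun z => toC4 (F z)) 𝒰

/-- `f` is, on `π (𝒰 × 𝕊)`, the slice function induced by `F`. -/
def IsInducedBy (𝒰 : Set ℂ) (f : ℍ[ℝ] → ℍ[ℝ]) (F : ℂ → ℂ ⊗[ℝ] ℍ[ℝ]) : Prop :=
  ∀ z ∈ 𝒰, ∀ I ∈ imagUnits, f (piC I z) = piT I (F z)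

/-- `f` is slice regular on `π (𝒰 × 𝕊)`: it is induced by a holomorphic stem function.
Values of `f` outside `π (𝒰 × 𝕊)` are irrelevant. -/
def IsSliceRegularOn (𝒰 : Set ℂ) (f : ℍ[ℝ] → ℍ[ℝ]) : Prop :=
  ∃ F : ℂ → ℂ ⊗[ℝ] ℍ[ℝ], IsStem 𝒰 F ∧ IsHolomorphicOn 𝒰 F ∧ IsInducedBy 𝒰 f F

end SliceRegular

end

noncomputable section

namespace SliceRegular

open Matrix

/-! Write the stem function in coordinates as `G : ℂ → ℂ⁴` and `evalC I w = Re w + I Im w`. The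
complex bilinear form `w ⬝ᵥ w` detects evaluation: it vanishes iff `evalC I w = 0` for some
imaginary unit `I` (`exists_evalC_eq_zero`, `dotProduct_self_eq_zero_of_evalC_eq_zero`). So `f`
takes the value `c` on the sphere of `z` iff the holomorphic function `(G z - c) ⬝ᵥ (G z - c)`
vanishes at `z`.

Let `c` be the value at a nonreal point. By injectivity this function has a single zero near the
point. If the zero were multiple, a Hurwitz argument (`eq_zero_of_isPreconnected_of_ne_zero`) would
make it multiple for all nearby `z` and all units `I`, since the sphere of units is connected.
Letting `I` vary then forces `G' = 0`, so `G` is locally constant, against injectivity. Hence the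
zero is simple (`dotProduct_deriv_ne_zero`). At real points a variant gives `G' ≠ 0`
(`deriv_ne_zero_of_real`).

At a nonreal point, split `h = ζ + η` with `ζ` in the plane `ℂ_I` and `η` orthogonal to it. Then `Df
h = ζ A + η s / y`, where `A = evalC I G'`, `s = Im G` and `y = Im z`. A kernel vector with `ζ ≠ 0`
makes `A` orthogonal to `s` and `I s`, which says exactly that the zero is multiple; one with `ζ =
0` is zero because `s ≠ 0`. At a real point `Df` is right multiplication by `G' ≠ 0`. -/

/-- The quaternion with the given coordinates. -/
def mkQ (a b c d : ℝ) : ℍ[ℝ] := ⟨a, b, c, d⟩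

@[simp] lemma re_mkQ (a b c d : ℝ) : (mkQ a b c d).re = a := rfl
@[simp] lemma imI_mkQ (a b c d : ℝ) : (mkQ a b c d).imI = b := rfl
@[simp] lemma imJ_mkQ (a b c d : ℝ) : (mkQ a b c d).imJ = c := rfl
@[simp] lemma imK_mkQ (a b c d : ℝ) : (mkQ a b c d).imK = d := rfl

/-! ### The sphere of imaginary units -/

lemma inner_eq_sum (a b : ℍ[ℝ]) :
    inner ℝ a b = a.re * b.re + a.imI * b.imI + a.imJ * b.imJ + a.imK * b.imK := by
  rw [Quaternion.inner_def]
  simp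

lemma mem_imagUnits_iff {I : ℍ[ℝ]} :
    I ∈ imagUnits ↔ I.re = 0 ∧ I.imI ^ 2 + I.imJ ^ 2 + I.imK ^ 2 = 1 := by
  have key : I ∈ imagUnits ↔ I * I = -1 := by simp [imagUnits, sq]
  rw [key]
  constructor
  · intro h
    have h0 := congrArg (·.re) h
    have h1 := congrArg (·.imI) h
    have h2 := congrArg (·.imJ) h
    have h3 := congrArg (·.imK) h
    simp at h0 h1 h2 h3
    have hre : I.re = 0 := by
      by_contra hne
      have e1 : I.imI = 0 := by
        have : I.re * I.imI = 0 := by linarith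
        simpa [hne] using this
      have e2 : I.imJ = 0 := by
        have : I.re * I.imJ = 0 := by linarith
        simpa [hne] using this
      have e3 : I.imK = 0 := by
        have : I.re * I.imK = 0 := by linarith
        simpa [hne] using this
      rw [e1, e2, e3] at h0
      nlinarith [sq_nonneg I.re]
    refine ⟨hre, ?_⟩
    rw [hre] at h0
    linarith
  · rintro ⟨h0, h1⟩
    ext <;> simp [h0] <;> linarith

lemma mul_self_of_mem_imagUnits {I : ℍ[ℝ]} (hI : I ∈ imagUnits) : I * I = -1 := by
  rw [← sq]; exact hI

lemma neg_mem_imagUnits {I : ℍ[ℝ]} (hI : I ∈ imagUnits) : -I ∈ imagUnits := by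
  simpa [imagUnits] using hI

lemma ne_zero_of_mem_imagUnits {I : ℍ[ℝ]} (hI : I ∈ imagUnits) : I ≠ 0 := by
  rintro rfl
  simp [imagUnits] at hI

lemma ne_neg_of_mem_imagUnits {I : ℍ[ℝ]} (hI : I ∈ imagUnits) : I ≠ -I := by
  intro h
  have h2 : (2 : ℝ) • I = 0 := by rw [two_smul]; exact add_eq_zero_iff_eq_neg.2 h
  exact ne_zero_of_mem_imagUnits hI ((smul_eq_zero.1 h2).resolve_left two_ne_zero)

lemma norm_of_mem_imagUnits {I : ℍ[ℝ]} (hI : I ∈ imagUnits) : ‖I‖ = 1 := by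
  obtain ⟨h0, h1⟩ := mem_imagUnits_iff.1 hI
  have h : ‖I‖ * ‖I‖ = 1 := by
    rw [← Quaternion.normSq_eq_norm_mul_self, Quaternion.normSq_def', h0]
    linarith
  nlinarith [norm_nonneg I]

/-- The imaginary quaternion with the given coordinates. -/
def imQuaternion : EuclideanSpace ℝ (Fin 3) →ₗ[ℝ] ℍ[ℝ] where
  toFun x := mkQ 0 (x 0) (x 1) (x 2)
  map_add' x y := by ext <;> simp
  map_smul' r x := by ext <;> simp

lemma image_sphere_eq_imagUnits :
    imQuaternion '' Metric.sphere (0 : EuclideanSpace ℝ (Fin 3)) 1 = imagUnits := by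
  have hs : ∀ x : EuclideanSpace ℝ (Fin 3),
      x ∈ Metric.sphere 0 1 ↔ x 0 ^ 2 + x 1 ^ 2 + x 2 ^ 2 = 1 := by
    intro x
    rw [mem_sphere_zero_iff_norm, EuclideanSpace.norm_eq, Real.sqrt_eq_one]
    simp [Fin.sum_univ_three]
  ext I
  rw [mem_imagUnits_iff]
  constructor
  · rintro ⟨x, hx, rfl⟩
    exact ⟨rfl, (hs x).1 hx⟩
  · rintro ⟨h0, h1⟩
    refine ⟨!₂[I.imI, I.imJ, I.imK], (hs _).2 (by simpa using h1), ?_⟩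
    ext <;> simp [imQuaternion, h0]

lemma isPreconnected_imagUnits : IsPreconnected imagUnits := by
  rw [← image_sphere_eq_imagUnits]
  refine (isPreconnected_sphere ?_ _ _).image _
    (LinearMap.continuous_of_finiteDimensional imQuaternion).continuousOn
  rw [← Module.finrank_eq_rank]
  simp

lemma isCompact_imagUnits : IsCompact imagUnits := by
  rw [← image_sphere_eq_imagUnits]
  exact (isCompact_sphere _ _).image (LinearMap.continuous_of_finiteDimensional imQuaternion)

/-! ### Evaluation in the coordinates of `ℂ⁴` -/

/-- The quaternion of real parts of a vector of `ℂ⁴`. -/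
def reQ : (Fin 4 → ℂ) →L[ℝ] ℍ[ℝ] := LinearMap.toContinuousLinearMap
  { toFun := fun w => mkQ (w 0).re (w 1).re (w 2).re (w 3).re
    map_add' := fun x y => by ext <;> simp
    map_smul' := fun r x => by ext <;> simp }

/-- The quaternion of imaginary parts of a vector of `ℂ⁴`. -/
def imQ : (Fin 4 → ℂ) →L[ℝ] ℍ[ℝ] := LinearMap.toContinuousLinearMap
  { toFun := fun w => mkQ (w 0).im (w 1).im (w 2).im (w 3).im
    map_add' := fun x y => by ext <;> simp
    map_smul' := fun r x => by ext <;> simp }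

/-- The embedding of `ℍ` in `ℂ⁴` as the real vectors. -/
def vecQ : ℍ[ℝ] →L[ℝ] (Fin 4 → ℂ) := LinearMap.toContinuousLinearMap
  { toFun := fun p => ![(p.re : ℂ), (p.imI : ℂ), (p.imJ : ℂ), (p.imK : ℂ)]
    map_add' := fun x y => by ext i; fin_cases i <;> simp
    map_smul' := fun r x => by ext i; fin_cases i <;> simp }

lemma reQ_apply (w : Fin 4 → ℂ) : reQ w = mkQ (w 0).re (w 1).re (w 2).re (w 3).re := rfl

lemma imQ_apply (w : Fin 4 → ℂ) : imQ w = mkQ (w 0).im (w 1).im (w 2).im (w 3).im := rfl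

lemma vecQ_apply (p : ℍ[ℝ]) :
    vecQ p = ![(p.re : ℂ), (p.imI : ℂ), (p.imJ : ℂ), (p.imK : ℂ)] := rfl

@[simp] lemma reQ_vecQ (p : ℍ[ℝ]) : reQ (vecQ p) = p := by
  ext <;> simp [reQ_apply, vecQ_apply]

@[simp] lemma imQ_vecQ (p : ℍ[ℝ]) : imQ (vecQ p) = 0 := by
  ext <;> simp [imQ_apply, vecQ_apply]

lemma ext_reQ_imQ {v w : Fin 4 → ℂ} (hr : reQ v = reQ w) (hi : imQ v = imQ w) : v = w := by
  rw [Quaternion.ext_iff] at hr hi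
  simp only [reQ_apply, imQ_apply, re_mkQ, imI_mkQ, imJ_mkQ, imK_mkQ] at hr hi
  ext i
  fin_cases i <;> apply Complex.ext <;> simp [hr, hi]

lemma vecQ_reQ_of_imQ_eq_zero {w : Fin 4 → ℂ} (h : imQ w = 0) : vecQ (reQ w) = w :=
  ext_reQ_imQ (by simp) (by simp [h])

lemma imQ_smul_I (w : Fin 4 → ℂ) : imQ (Complex.I • w) = reQ w := by
  ext <;> simp [imQ_apply, reQ_apply]

lemma reQ_smul_I (w : Fin 4 → ℂ) : reQ (Complex.I • w) = -imQ w := by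
  ext <;> simp [imQ_apply, reQ_apply]

/-- The map `π` in the coordinates of `ℂ⁴`. -/
def evalC (I : ℍ[ℝ]) (w : Fin 4 → ℂ) : ℍ[ℝ] := reQ w + I * imQ w

lemma stdBasis_repr (p : ℍ[ℝ]) (i : Fin 4) :
    stdBasis.repr p i = ![p.re, p.imI, p.imJ, p.imK] i :=
  congrFun (QuaternionAlgebra.coe_basisOneIJK_repr (-1 : ℝ) 0 (-1) p) i

lemma toC4_tmul (z : ℂ) (p : ℍ[ℝ]) : toC4 (z ⊗ₜ[ℝ] p) = z • vecQ p := by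
  ext i
  rw [toC4, Module.Basis.equivFun_apply, Algebra.TensorProduct.basis_repr_tmul,
    Finsupp.smul_apply, Finsupp.mapRange_apply, stdBasis_repr, vecQ_apply]
  fin_cases i <;> simp

lemma evalC_add (I : ℍ[ℝ]) (v w : Fin 4 → ℂ) : evalC I (v + w) = evalC I v + evalC I w := by
  simp only [evalC, map_add, mul_add]; abel

lemma evalC_sub (I : ℍ[ℝ]) (v w : Fin 4 → ℂ) : evalC I (v - w) = evalC I v - evalC I w := by
  simp only [evalC, map_sub, mul_sub]; abel

@[simp] lemma evalC_vecQ (I p : ℍ[ℝ]) : evalC I (vecQ p) = p := by simp [evalC]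

lemma smul_eq_re_im (z : ℂ) (w : Fin 4 → ℂ) :
    z • w = z.re • w + z.im • (Complex.I • w) := by
  ext i
  simp only [Pi.smul_apply, Pi.add_apply, smul_eq_mul, Complex.real_smul]
  conv_lhs => rw [← Complex.re_add_im z]
  ring

lemma evalC_smul {I : ℍ[ℝ]} (hI : I ∈ imagUnits) (z : ℂ) (w : Fin 4 → ℂ) :
    evalC I (z • w) = piC I z * evalC I w := by
  rw [smul_eq_re_im]
  simp only [evalC, map_add, map_smul, imQ_smul_I, reQ_smul_I, piC, LinearMap.coe_mk,
    AddHom.coe_mk, Quaternion.mul_coe_eq_smul, add_mul, mul_add, Quaternion.coe_mul_eq_smul,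
    smul_mul_assoc, mul_smul_comm, ← mul_assoc, mul_self_of_mem_imagUnits hI]
  simp only [smul_neg, neg_mul, one_mul]
  abel

lemma evalC_toC4 {I : ℍ[ℝ]} (hI : I ∈ imagUnits) (x : ℂ ⊗[ℝ] ℍ[ℝ]) :
    piT I x = evalC I (toC4 x) := by
  induction x with
  | zero => simp [evalC]
  | add x y hx hy => rw [map_add, map_add, evalC_add, hx, hy]
  | tmul z p => rw [toC4_tmul, evalC_smul hI, evalC_vecQ]; simp [piT]

lemma toC4_conjT (x : ℂ ⊗[ℝ] ℍ[ℝ]) :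
    reQ (toC4 (conjT x)) = reQ (toC4 x) ∧ imQ (toC4 (conjT x)) = -imQ (toC4 x) := by
  induction x with
  | zero => simp
  | add x y hx hy =>
    simp only [map_add, hx.1, hy.1, hx.2, hy.2, true_and]
    abel
  | tmul z p =>
    have : conjT (z ⊗ₜ[ℝ] p) = conj z ⊗ₜ[ℝ] p := by simp [conjT]
    rw [this, toC4_tmul, toC4_tmul, smul_eq_re_im, smul_eq_re_im z]
    simp [imQ_smul_I, reQ_smul_I]

/-! ### The complex bilinear form and zeros of evaluation -/

lemma dotProduct_self_re (w : Fin 4 → ℂ) :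
    (w ⬝ᵥ w).re = inner ℝ (reQ w) (reQ w) - inner ℝ (imQ w) (imQ w) := by
  simp [dotProduct, Fin.sum_univ_four, inner_eq_sum, reQ_apply, imQ_apply,
    -inner_self_eq_norm_sq_to_K]
  ring

lemma dotProduct_self_im (w : Fin 4 → ℂ) :
    (w ⬝ᵥ w).im = 2 * inner ℝ (reQ w) (imQ w) := by
  simp [dotProduct, Fin.sum_univ_four, inner_eq_sum, reQ_apply, imQ_apply,
    -inner_self_eq_norm_sq_to_K]
  ring

lemma imagUnits_nonempty : imagUnits.Nonempty :=
  ⟨mkQ 0 1 0 0, mem_imagUnits_iff.2 ⟨rfl, by simp⟩⟩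

lemma inner_mul_left_mul_left (x a b : ℍ[ℝ]) :
    inner ℝ (x * a) (x * b) = inner ℝ x x * inner ℝ a b := by
  simp only [inner_eq_sum, Quaternion.re_mul, Quaternion.imI_mul, Quaternion.imJ_mul,
    Quaternion.imK_mul]
  ring

lemma inner_mul_right_mul_right (x a b : ℍ[ℝ]) :
    inner ℝ (a * x) (b * x) = inner ℝ x x * inner ℝ a b := by
  simp only [inner_eq_sum, Quaternion.re_mul, Quaternion.imI_mul, Quaternion.imJ_mul,
    Quaternion.imK_mul]
  ring

/-- Isotropy says that `Re w` and `Im w` are orthogonal and of equal norm, so `-(Re w) (Im w)⁻¹` has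
norm one and is orthogonal to `1`: it is an imaginary unit. -/
lemma exists_evalC_eq_zero {w : Fin 4 → ℂ} (h : w ⬝ᵥ w = 0) :
    ∃ I ∈ imagUnits, evalC I w = 0 := by
  have h1 := dotProduct_self_re w
  have h2 := dotProduct_self_im w
  rw [h] at h1 h2
  simp only [Complex.zero_re, Complex.zero_im] at h1 h2
  by_cases hi : imQ w = 0
  · obtain ⟨I, hI⟩ := imagUnits_nonempty
    refine ⟨I, hI, ?_⟩
    have : reQ w = 0 := by
      rw [← inner_self_eq_zero (𝕜 := ℝ)]
      rw [hi, inner_zero_left] at h1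
      linarith
    simp [evalC, hi, this]
  · have hpos : inner ℝ (imQ w) (imQ w) ≠ (0 : ℝ) := inner_self_eq_zero.not.2 hi
    have hr : -(reQ w * (imQ w)⁻¹) * imQ w = -reQ w := by
      rw [neg_mul, mul_assoc, inv_mul_cancel₀ hi, mul_one]
    refine ⟨-(reQ w * (imQ w)⁻¹), ?_, by rw [evalC, hr, add_neg_cancel]⟩
    generalize -(reQ w * (imQ w)⁻¹) = I at hr
    have e1 : inner ℝ (imQ w) (imQ w) * inner ℝ I I = (inner ℝ (imQ w) (imQ w) : ℝ) := by
      rw [← inner_mul_right_mul_right, hr, inner_neg_neg]; linarith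
    have e2 : inner ℝ (imQ w) (imQ w) * inner ℝ I 1 = (0 : ℝ) := by
      rw [← inner_mul_right_mul_right, hr, one_mul, inner_neg_left]; linarith
    have e1' : inner ℝ I I = (1 : ℝ) := mul_left_cancel₀ hpos (by rw [e1, mul_one])
    have e2' : inner ℝ I 1 = (0 : ℝ) := (mul_eq_zero.1 e2).resolve_left hpos
    simp only [inner_eq_sum] at e1' e2'
    simp only [Quaternion.re_one, Quaternion.imI_one, Quaternion.imJ_one, Quaternion.imK_one,
      mul_one, mul_zero, add_zero] at e2'
    refine mem_imagUnits_iff.2 ⟨e2', ?_⟩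
    rw [e2'] at e1'
    linarith

/-- Here `w = -I s + √-1 s` with `s = Im w`, so pairing with `w` only sees `evalC I v` against `s`
and `I s`. This translates between the holomorphic condition and the real differential. -/
lemma dotProduct_of_evalC_eq_zero {I : ℍ[ℝ]} (hI : I ∈ imagUnits) {w : Fin 4 → ℂ}
    (hw : evalC I w = 0) (v : Fin 4 → ℂ) :
    v ⬝ᵥ w = ⟨-inner ℝ (evalC I v) (I * imQ w), inner ℝ (evalC I v) (imQ w)⟩ := by
  have hr : reQ w = -(I * imQ w) := eq_neg_of_add_eq_zero_left hw
  obtain ⟨h0, h1⟩ := mem_imagUnits_iff.1 hI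
  have a0 := congrArg (·.re) hr
  have a1 := congrArg (·.imI) hr
  have a2 := congrArg (·.imJ) hr
  have a3 := congrArg (·.imK) hr
  simp only [reQ_apply, imQ_apply, Quaternion.re_neg, Quaternion.imI_neg, Quaternion.imJ_neg,
    Quaternion.imK_neg, Quaternion.re_mul, Quaternion.imI_mul, Quaternion.imJ_mul,
    Quaternion.imK_mul, h0, re_mkQ, imI_mkQ, imJ_mkQ, imK_mkQ] at a0 a1 a2 a3
  apply Complex.ext
  · simp [dotProduct, Fin.sum_univ_four, inner_eq_sum, reQ_apply, imQ_apply, evalC, h0,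
      a0, a1, a2, a3]
    linear_combination ((v 0).im * (w 0).im + (v 1).im * (w 1).im + (v 2).im * (w 2).im
      + (v 3).im * (w 3).im) * h1
  · simp [dotProduct, Fin.sum_univ_four, inner_eq_sum, reQ_apply, imQ_apply, evalC, h0,
      a0, a1, a2, a3]
    ring

lemma dotProduct_self_eq_zero_of_evalC_eq_zero {I : ℍ[ℝ]} (hI : I ∈ imagUnits) {w : Fin 4 → ℂ}
    (hw : evalC I w = 0) : w ⬝ᵥ w = 0 := by
  rw [dotProduct_of_evalC_eq_zero hI hw, hw]
  simp
  rfl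

open Metric Set Filter Topology

/-! ### A Hurwitz type argument -/

/-- A nonvanishing holomorphic function on a closed disc satisfies the minimum principle. -/
lemma le_norm_of_forall_sphere_le_norm {h : ℂ → ℂ} {z₀ w : ℂ} {r c : ℝ} (hr : 0 < r) (hc : 0 < c)
    (hd : DifferentiableOn ℂ h (closedBall z₀ r)) (hne : ∀ z ∈ closedBall z₀ r, h z ≠ 0)
    (hb : ∀ z ∈ sphere z₀ r, c ≤ ‖h z‖) (hw : w ∈ closedBall z₀ r) : c ≤ ‖h w‖ := by
  have hdi : DifferentiableOn ℂ (fun z => (h z)⁻¹) (closedBall z₀ r) := hd.inv hne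
  have hcl := hdi.diffContOnCl_ball subset_rfl
  have := Complex.norm_le_of_forall_mem_frontier_norm_le (C := c⁻¹) isBounded_ball hcl
    (z := w) (fun z hz => ?_) (by rwa [closure_ball _ hr.ne'])
  · rw [norm_inv] at this
    exact (inv_le_inv₀ (norm_pos_iff.2 (hne w hw)) hc).1 this
  · rw [frontier_ball _ hr.ne'] at hz
    rw [norm_inv]
    exact inv_anti₀ hc (hb z hz)

/-- A Hurwitz type theorem: if a continuous family of holomorphic functions on a disc, with
compact connected parameter space, vanishes at most at one prescribed point `a k` of the disc, then
either all or none of its members vanish there. -/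
lemma eq_zero_of_isPreconnected_of_ne_zero {X : Type*} [TopologicalSpace X] {K : Set X}
    (hK : IsCompact K) (hKc : IsPreconnected K) {z₀ : ℂ} {r : ℝ} (hr : 0 < r) {a : X → ℂ}
    (ha : ∀ k ∈ K, a k ∈ ball z₀ r) {h : X → ℂ → ℂ}
    (hd : ∀ k ∈ K, DifferentiableOn ℂ (h k) (closedBall z₀ r))
    (hne : ∀ k ∈ K, ∀ z ∈ closedBall z₀ r, z ≠ a k → h k z ≠ 0)
    (hcont : ContinuousOn (fun x : X × ℂ => h x.1 x.2) (K ×ˢ sphere z₀ r))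
    (hca : ContinuousOn (fun k => h k (a k)) K) {k₀ : X} (hk₀ : k₀ ∈ K)
    (h₀ : h k₀ (a k₀) = 0) {k : X} (hk : k ∈ K) : h k (a k) = 0 := by
  have hsph : ∀ k ∈ K, ∀ z ∈ sphere z₀ r, h k z ≠ 0 := by
    intro k hk z hz
    refine hne k hk z (sphere_subset_closedBall hz) ?_
    rintro rfl
    exact (ne_of_lt (mem_ball.1 (ha k hk))) (mem_sphere.1 hz)
  obtain ⟨c, hc, hcb⟩ : ∃ c > 0, ∀ x ∈ K ×ˢ sphere z₀ r, c ≤ ‖h x.1 x.2‖ := by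
    obtain ⟨x, hx, hmin⟩ := (hK.prod (isCompact_sphere z₀ r)).exists_isMinOn
      (Nonempty.prod ⟨k₀, hk₀⟩ (NormedSpace.sphere_nonempty.2 hr.le)) hcont.norm
    exact ⟨_, norm_pos_iff.2 (hsph _ hx.1 _ hx.2), fun y hy => hmin hy⟩
  -- A member that does not vanish at `a k` has no zero in the disc, so the minimum principle
  -- carries the uniform boundary bound `c` inside.
  have hdich : ∀ k ∈ K, h k (a k) ≠ 0 → c ≤ ‖h k (a k)‖ := by
    intro k hk hz
    refine le_norm_of_forall_sphere_le_norm hr hc (hd k hk) (fun z hz' => ?_)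
      (fun z hz' => hcb (k, z) ⟨hk, hz'⟩) (ball_subset_closedBall (ha k hk))
    by_cases hza : z = a k
    · rwa [hza]
    · exact hne k hk z hz' hza
  by_contra hz
  -- By connectedness the norm would take the value `c / 2`, inside the forbidden gap between `0`
  -- and `c`.
  have hmem : c / 2 ∈ Icc ‖h k₀ (a k₀)‖ ‖h k (a k)‖ := by
    rw [h₀, norm_zero]
    exact ⟨by positivity, by linarith [hdich k hk hz]⟩
  obtain ⟨k', hk', he⟩ := hKc.intermediate_value hk₀ hk hca.norm hmem
  have hpos : h k' (a k') ≠ 0 := norm_pos_iff.1 (by simp only at he; rw [he]; positivity)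
  have := hdich k' hk' hpos
  simp only at he
  linarith

/-! ### Orthogonality to all the products `I s` -/

/-- Right multiplication by `s` is a similarity, so `s, i s, j s, k s` is an orthogonal basis. -/
lemma eq_zero_of_inner_mul_eq_zero {x s : ℍ[ℝ]} (hs : s ≠ 0) (h₁ : inner ℝ x s = (0 : ℝ))
    (h : ∀ I ∈ imagUnits, inner ℝ x (I * s) = (0 : ℝ)) : x = 0 := by
  have hpos : inner ℝ s s ≠ (0 : ℝ) := inner_self_eq_zero.not.2 hs
  have hx : x = x * s⁻¹ * s := by rw [mul_assoc, inv_mul_cancel₀ hs, mul_one]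
  have key : ∀ p : ℍ[ℝ], inner ℝ x (p * s) = (0 : ℝ) → inner ℝ (x * s⁻¹) p = (0 : ℝ) := by
    intro p hp
    rw [hx, inner_mul_right_mul_right] at hp
    exact (mul_eq_zero.1 hp).resolve_left hpos
  have k0 := key 1 (by rwa [one_mul])
  have k1 := key _ (h (mkQ 0 1 0 0) (mem_imagUnits_iff.2 (by simp)))
  have k2 := key _ (h (mkQ 0 0 1 0) (mem_imagUnits_iff.2 (by simp)))
  have k3 := key _ (h (mkQ 0 0 0 1) (mem_imagUnits_iff.2 (by simp)))
  generalize x * s⁻¹ = y at *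
  rw [inner_eq_sum] at k0 k1 k2 k3
  have : y = 0 := by
    ext
    · simpa using k0
    · simpa using k1
    · simpa using k2
    · simpa using k3
  rw [hx, this, zero_mul]

lemma inner_mul_imagUnit {I : ℍ[ℝ]} (hI : I ∈ imagUnits) (x s : ℍ[ℝ]) :
    inner ℝ (I * x) s = (-inner ℝ x (I * s) : ℝ) := by
  obtain ⟨h0, -⟩ := mem_imagUnits_iff.1 hI
  simp only [inner_eq_sum, Quaternion.re_mul, Quaternion.imI_mul, Quaternion.imJ_mul,
    Quaternion.imK_mul, h0]
  ring

/-- Comparing the conditions for `I` and `-I` separates `Re v` from `Im v`; each is then orthogonal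
to `s` and to every `I s`. -/
lemma eq_zero_of_forall_inner_evalC {v : Fin 4 → ℂ} {s : ℍ[ℝ]} (hs : s ≠ 0)
    (h₁ : ∀ I ∈ imagUnits, inner ℝ (evalC I v) s = (0 : ℝ))
    (h₂ : ∀ I ∈ imagUnits, inner ℝ (evalC I v) (I * s) = (0 : ℝ)) : v = 0 := by
  have a1 : ∀ I ∈ imagUnits, inner ℝ (reQ v) s = (0 : ℝ) ∧ inner ℝ (imQ v) (I * s) = (0 : ℝ) := by
    intro I hI
    have e1 := h₁ I hI
    have e2 := h₁ _ (neg_mem_imagUnits hI)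
    simp only [evalC, inner_add_left, neg_mul, inner_neg_left, inner_mul_imagUnit hI] at e1 e2
    constructor <;> linarith
  have a2 : ∀ I ∈ imagUnits, inner ℝ (imQ v) s = (0 : ℝ) ∧ inner ℝ (reQ v) (I * s) = (0 : ℝ) := by
    intro I hI
    have e1 := h₂ I hI
    have e2 := h₂ _ (neg_mem_imagUnits hI)
    simp only [evalC, inner_add_left, neg_mul, inner_neg_left, inner_neg_right,
      inner_mul_imagUnit hI, ← mul_assoc, mul_self_of_mem_imagUnits hI, one_mul] at e1 e2
    constructor <;> linarith
  obtain ⟨I, hI⟩ := imagUnits_nonempty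
  refine ext_reQ_imQ ?_ ?_
  · rw [map_zero]
    exact eq_zero_of_inner_mul_eq_zero hs (a1 I hI).1 fun J hJ => (a2 J hJ).2
  · rw [map_zero]
    exact eq_zero_of_inner_mul_eq_zero hs (a2 I hI).1 fun J hJ => (a1 J hJ).2

/-! ### Nonvanishing of the derivatives -/

lemma continuousOn_dotProduct {X : Type*} [TopologicalSpace X] {s : Set X}
    {v w : X → Fin 4 → ℂ} (hv : ContinuousOn v s) (hw : ContinuousOn w s) :
    ContinuousOn (fun x => v x ⬝ᵥ w x) s := by
  unfold dotProduct
  exact continuousOn_finsetSum _ fun i _ =>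
    (continuousOn_pi.1 hv i).mul (continuousOn_pi.1 hw i)

lemma continuousOn_dslope_prod {X E : Type*} [TopologicalSpace X] [NormedAddCommGroup E]
    [NormedSpace ℂ E] {K : Set X} {s : Set ℂ} {φ : X → ℂ → E} {a : X → ℂ}
    (ha : ContinuousOn a K) (hne : ∀ k ∈ K, ∀ z ∈ s, z ≠ a k)
    (hφ : ContinuousOn (fun x : X × ℂ => φ x.1 x.2) (K ×ˢ s))
    (hφa : ContinuousOn (fun k => φ k (a k)) K) :
    ContinuousOn (fun x : X × ℂ => dslope (φ x.1) (a x.1) x.2) (K ×ˢ s) := by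
  have ha' : ContinuousOn (fun x : X × ℂ => a x.1) (K ×ˢ s) :=
    ContinuousOn.comp' ha continuousOn_fst fun x hx => hx.1
  have hφa' : ContinuousOn (fun x : X × ℂ => φ x.1 (a x.1)) (K ×ˢ s) :=
    ContinuousOn.comp' hφa continuousOn_fst fun x hx => hx.1
  refine ContinuousOn.congr (((continuousOn_snd.sub ha').inv₀ fun x hx =>
    sub_ne_zero.2 (hne x.1 hx.1 x.2 hx.2)).smul (hφ.sub hφa')) fun x hx => ?_
  exact dslope_of_ne _ (hne x.1 hx.1 x.2 hx.2)

lemma hasDerivAt_dotProduct_self {g : ℂ → Fin 4 → ℂ} {g' : Fin 4 → ℂ} {z : ℂ}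
    (hg : HasDerivAt g g' z) : HasDerivAt (fun z => g z ⬝ᵥ g z) (2 * (g' ⬝ᵥ g z)) z := by
  have h := fun i => hasDerivAt_pi.1 hg i
  have := HasDerivAt.fun_sum (u := Finset.univ) fun i _ => (h i).mul (h i)
  refine this.congr_deriv ?_
  rw [dotProduct, Finset.mul_sum]
  exact Finset.sum_congr rfl fun i _ => by ring

lemma continuousOn_evalC_comp {X : Type*} [TopologicalSpace X] {s : Set X} {I : X → ℍ[ℝ]}
    {g : X → Fin 4 → ℂ} (hI : ContinuousOn I s) (hg : ContinuousOn g s) :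
    ContinuousOn (fun x => evalC (I x) (g x)) s :=
  (reQ.continuous.comp_continuousOn hg).add (hI.mul (imQ.continuous.comp_continuousOn hg))

/-- Off the real axis, injectivity forces the derivative of the (quadratic) equation for the
preimages of a value to be nonzero. -/
lemma dotProduct_deriv_ne_zero {G : ℂ → Fin 4 → ℂ} {U : Set ℂ} (hU : IsOpen U)
    (hG : DifferentiableOn ℂ G U) {z₀ : ℂ} {r : ℝ} (hr : 0 < r) (hrU : closedBall z₀ r ⊆ U)
    (hinj : ∀ z ∈ closedBall z₀ r, ∀ z' ∈ closedBall z₀ r, ∀ I ∈ imagUnits, ∀ J ∈ imagUnits,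
      evalC I (G z) = evalC J (G z') → z = z' ∧ I = J)
    {I₀ : ℍ[ℝ]} (hI₀ : I₀ ∈ imagUnits) :
    deriv G z₀ ⬝ᵥ (G z₀ - vecQ (evalC I₀ (G z₀))) ≠ 0 := by
  intro h0
  have hball : closedBall z₀ (r / 2) ⊆ ball z₀ r := closedBall_subset_ball (by linarith)
  have hball' : closedBall z₀ (r / 2) ⊆ U := (hball.trans ball_subset_closedBall).trans hrU
  -- `φ k` vanishes at `z` iff `evalC J (G z)` equals the value attached to `k` for some unit `J`.
  let φ : ℂ × ℍ[ℝ] → ℂ → ℂ := fun k z =>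
    (G z - vecQ (evalC k.2 (G k.1))) ⬝ᵥ (G z - vecQ (evalC k.2 (G k.1)))
  have hφ : ∀ k, ∀ z ∈ U,
      HasDerivAt (φ k) (2 * (deriv G z ⬝ᵥ (G z - vecQ (evalC k.2 (G k.1))))) z := fun k z hz =>
    hasDerivAt_dotProduct_self
      ((hG.differentiableAt (hU.mem_nhds hz)).hasDerivAt.sub_const _)
  have hφ0 : ∀ k : ℂ × ℍ[ℝ], k.2 ∈ imagUnits → φ k k.1 = 0 := fun k hk =>
    dotProduct_self_eq_zero_of_evalC_eq_zero hk (by rw [evalC_sub, evalC_vecQ, sub_self])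
  have hcG : ContinuousOn G U := hG.continuousOn
  have hcG' : ContinuousOn (deriv G) U := (hG.deriv hU).continuousOn
  have cG : ContinuousOn (fun k : ℂ × ℍ[ℝ] => G k.1) (closedBall z₀ (r / 2) ×ˢ imagUnits) :=
    ContinuousOn.comp' hcG continuousOn_fst fun x hx => hball' hx.1
  have c0 : ContinuousOn (fun k : ℂ × ℍ[ℝ] => evalC k.2 (G k.1))
      (closedBall z₀ (r / 2) ×ˢ imagUnits) := continuousOn_evalC_comp continuousOn_snd cG
  -- The slope divides out the known zero `k.1`; its value there is the derivative of `φ k`, so a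
  -- zero persists iff the root is multiple.
  have hmain : ∀ k ∈ closedBall z₀ (r / 2) ×ˢ imagUnits, dslope (φ k) k.1 k.1 = 0 := by
    intro k hk
    refine eq_zero_of_isPreconnected_of_ne_zero (h := fun k => dslope (φ k) k.1)
      (k₀ := (z₀, I₀)) (a := Prod.fst)
      ((isCompact_closedBall _ _).prod isCompact_imagUnits)
      ((convex_closedBall _ _).isPreconnected.prod isPreconnected_imagUnits) hr
      (fun k hk => hball hk.1) ?_ ?_ ?_ ?_ ⟨mem_closedBall_self (by linarith), hI₀⟩ ?_ hk
    · intro k hk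
      refine DifferentiableOn.mono ((Complex.differentiableOn_dslope (s := U) ?_).2 ?_) hrU
      · exact hU.mem_nhds (hball' hk.1)
      · exact fun z hz => (hφ k z hz).differentiableAt.differentiableWithinAt
    · intro k hk z hz hza h
      rw [dslope_of_ne _ hza, slope_def_field, hφ0 k hk.2, sub_zero, div_eq_zero_iff] at h
      obtain ⟨J, hJ, hJ0⟩ := exists_evalC_eq_zero (h.resolve_right (sub_ne_zero.2 hza))
      rw [evalC_sub, evalC_vecQ, sub_eq_zero] at hJ0
      exact hza (hinj z hz k.1 (ball_subset_closedBall (hball hk.1)) J hJ k.2 hk.2 hJ0).1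
    · refine continuousOn_dslope_prod (φ := φ) (a := Prod.fst) continuousOn_fst ?_ ?_ ?_
      · rintro k hk z hz rfl
        exact (mem_ball.1 (hball hk.1)).ne (mem_sphere.1 hz)
      · have e1 : ContinuousOn (fun x : (ℂ × ℍ[ℝ]) × ℂ => G x.2)
            ((closedBall z₀ (r / 2) ×ˢ imagUnits) ×ˢ sphere z₀ r) :=
          ContinuousOn.comp' hcG continuousOn_snd fun x hx => hrU (sphere_subset_closedBall hx.2)
        have e2 : ContinuousOn (fun x : (ℂ × ℍ[ℝ]) × ℂ => evalC x.1.2 (G x.1.1))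
            ((closedBall z₀ (r / 2) ×ˢ imagUnits) ×ˢ sphere z₀ r) :=
          ContinuousOn.comp' c0 continuousOn_fst fun x hx => hx.1
        have e3 := e1.sub (vecQ.continuous.comp_continuousOn e2)
        exact continuousOn_dotProduct e3 e3
      · exact continuousOn_const.congr fun k hk => hφ0 k hk.2
    · have c3 : ContinuousOn (fun k : ℂ × ℍ[ℝ] => deriv G k.1)
          (closedBall z₀ (r / 2) ×ˢ imagUnits) :=
        ContinuousOn.comp' hcG' continuousOn_fst fun x hx => hball' hx.1
      have c1 : ContinuousOn (fun k : ℂ × ℍ[ℝ] =>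
          2 * (deriv G k.1 ⬝ᵥ (G k.1 - vecQ (evalC k.2 (G k.1)))))
          (closedBall z₀ (r / 2) ×ˢ imagUnits) :=
        continuousOn_const.mul (continuousOn_dotProduct c3
          (cG.sub (vecQ.continuous.comp_continuousOn c0)))
      refine c1.congr fun k hk => ?_
      simp only [dslope_same]
      exact (hφ k k.1 (hball' hk.1)).deriv
    · simp only [dslope_same]
      rw [(hφ _ z₀ (hrU (mem_closedBall_self hr.le))).deriv, h0, mul_zero]
  have hG0 : ∀ z ∈ closedBall z₀ (r / 2), deriv G z = 0 := by
    intro z hz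
    have hzr := ball_subset_closedBall (hball hz)
    -- Otherwise `I₀` and `-I₀` would give the same value.
    have hs : imQ (G z) ≠ 0 := by
      intro hs
      have := (hinj z hzr z hzr I₀ hI₀ (-I₀) (neg_mem_imagUnits hI₀) (by simp [evalC, hs])).2
      exact ne_neg_of_mem_imagUnits hI₀ this
    have key : ∀ I ∈ imagUnits, inner ℝ (evalC I (deriv G z)) (I * imQ (G z)) = (0 : ℝ) ∧
        inner ℝ (evalC I (deriv G z)) (imQ (G z)) = (0 : ℝ) := by
      intro I hI
      have h := hmain (z, I) ⟨hz, hI⟩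
      rw [dslope_same, (hφ _ z (hball' hz)).deriv,
        dotProduct_of_evalC_eq_zero hI (by rw [evalC_sub, evalC_vecQ, sub_self])] at h
      have h := (mul_eq_zero.1 h).resolve_left two_ne_zero
      simpa [Complex.ext_iff] using h
    exact eq_zero_of_forall_inner_evalC hs (fun I hI => (key I hI).2) fun I hI => (key I hI).1
  have hconst := isOpen_ball.is_const_of_deriv_eq_zero (s := ball z₀ (r / 2))
    (convex_ball _ _).isPreconnected (hG.mono (ball_subset_closedBall.trans hball'))
    (fun z hz => hG0 z (ball_subset_closedBall hz))
    (x := z₀) (y := z₀ + (r / 4 : ℝ)) (mem_ball_self (by linarith))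
    (by rw [mem_ball, dist_self_add_left, Complex.norm_real, Real.norm_of_nonneg (by linarith)]
        linarith)
  have := (hinj z₀ (mem_closedBall_self hr.le) (z₀ + (r / 4 : ℝ))
    (by rw [mem_closedBall, dist_self_add_left, Complex.norm_real,
          Real.norm_of_nonneg (by linarith)]
        linarith) I₀ hI₀ I₀ hI₀ (by rw [hconst])).1
  rw [left_eq_add, Complex.ofReal_eq_zero] at this
  linarith

/-- The real case: if `G` is real on the real axis and takes the value `G t` on no sphere other
than `t` itself, then its derivative is nonzero. -/
lemma deriv_ne_zero_of_real {G : ℂ → Fin 4 → ℂ} {U : Set ℂ} (hU : IsOpen U)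
    (hG : DifferentiableOn ℂ G U) {x₀ r : ℝ} (hr : 0 < r) (hrU : closedBall (x₀ : ℂ) r ⊆ U)
    (hreal : ∀ t : ℝ, (t : ℂ) ∈ U → imQ (G t) = 0)
    (hreal' : ∀ t : ℝ, (t : ℂ) ∈ U → imQ (deriv G t) = 0)
    (hinj : ∀ z ∈ closedBall (x₀ : ℂ) r, ∀ t : ℝ, (t : ℂ) ∈ closedBall (x₀ : ℂ) r →
      ∀ I ∈ imagUnits, evalC I (G z) = reQ (G t) → z = t) :
    deriv G x₀ ≠ 0 := by
  intro h0
  have hdist : ∀ t ∈ Icc (x₀ - r / 2) (x₀ + r / 2), (t : ℂ) ∈ ball (x₀ : ℂ) r := by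
    intro t ht
    rw [mem_ball, Complex.dist_of_im_eq (by simp), Complex.ofReal_re, Complex.ofReal_re,
      Real.dist_eq, abs_lt]
    constructor <;> linarith [ht.1, ht.2]
  have htU : ∀ t ∈ Icc (x₀ - r / 2) (x₀ + r / 2), (t : ℂ) ∈ U := fun t ht =>
    hrU (ball_subset_closedBall (hdist t ht))
  have hofReal : ContinuousOn (fun t : ℝ => (t : ℂ)) (Icc (x₀ - r / 2) (x₀ + r / 2)) :=
    Complex.continuous_ofReal.continuousOn
  have hx₀ : x₀ ∈ Icc (x₀ - r / 2) (x₀ + r / 2) := ⟨by linarith, by linarith⟩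
  -- Here the square of `G z - G t` has at least a double zero at `t`, so `G` is divided by `z - t`
  -- before the form is applied.
  have hmain : ∀ t ∈ Icc (x₀ - r / 2) (x₀ + r / 2), deriv G t ⬝ᵥ deriv G t = 0 := by
    intro t ht
    have := eq_zero_of_isPreconnected_of_ne_zero
      (h := fun (t : ℝ) z => dslope G t z ⬝ᵥ dslope G t z)
      (k₀ := x₀) (a := fun t : ℝ => (t : ℂ)) isCompact_Icc isPreconnected_Icc hr hdist
      ?_ ?_ ?_ ?_ hx₀ ?_ ht
    · simpa only [dslope_same] using this
    · intro k hk
      have hd : DifferentiableOn ℂ (dslope G k) U :=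
        (Complex.differentiableOn_dslope (hU.mem_nhds (htU k hk))).2 hG
      intro z hz
      exact (hasDerivAt_dotProduct_self (hd.differentiableAt
        (hU.mem_nhds (hrU hz))).hasDerivAt).differentiableAt.differentiableWithinAt
    · intro k hk z hz hza h
      rw [dslope_of_ne _ hza, slope_def_module, smul_dotProduct, dotProduct_smul, smul_smul,
        smul_eq_zero] at h
      have h := h.resolve_left (mul_self_ne_zero.2 (inv_ne_zero (sub_ne_zero.2 hza)))
      obtain ⟨J, hJ, hJ0⟩ := exists_evalC_eq_zero h
      rw [← vecQ_reQ_of_imQ_eq_zero (hreal k (htU k hk)), evalC_sub, evalC_vecQ,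
        sub_eq_zero] at hJ0
      exact hza (hinj z hz k (ball_subset_closedBall (hdist k hk)) J hJ hJ0)
    · have e : ContinuousOn (fun x : ℝ × ℂ => dslope G x.1 x.2)
          (Icc (x₀ - r / 2) (x₀ + r / 2) ×ˢ sphere (x₀ : ℂ) r) := by
        refine continuousOn_dslope_prod (φ := fun _ => G) hofReal ?_ ?_ ?_
        · rintro k hk z hz rfl
          exact (mem_ball.1 (hdist k hk)).ne (mem_sphere.1 hz)
        · exact ContinuousOn.comp' hG.continuousOn continuousOn_snd fun x hx =>
            hrU (sphere_subset_closedBall hx.2)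
        · exact ContinuousOn.comp' hG.continuousOn hofReal htU
      exact continuousOn_dotProduct e e
    · simp only [dslope_same]
      have e : ContinuousOn (fun t : ℝ => deriv G t) (Icc (x₀ - r / 2) (x₀ + r / 2)) :=
        ContinuousOn.comp' (hG.deriv hU).continuousOn hofReal htU
      exact continuousOn_dotProduct e e
    · simp only [dslope_same]
      rw [h0, zero_dotProduct]
  -- On real vectors the form is the squared norm, so an isotropic `G' t` is zero.
  have hG0 : ∀ t ∈ Icc (x₀ - r / 2) (x₀ + r / 2), deriv G t = 0 := by
    intro t ht
    have h1 := dotProduct_self_re (deriv G t)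
    rw [hmain t ht, hreal' t (htU t ht), inner_zero_left, sub_zero, Complex.zero_re] at h1
    exact ext_reQ_imQ (by rw [map_zero]; exact inner_self_eq_zero.1 h1.symm)
      (by rw [map_zero]; exact hreal' t (htU t ht))
  have hder : ∀ t ∈ Icc (x₀ - r / 2) (x₀ + r / 2), HasDerivAt (fun t : ℝ => G t) 0 t := by
    intro t ht
    have := (hG.differentiableAt (hU.mem_nhds (htU t ht))).hasDerivAt
    rw [hG0 t ht] at this
    have h := this.scomp t Complex.ofRealCLM.hasDerivAt
    rw [smul_zero] at h
    exact h
  have hconst := constant_of_has_deriv_right_zero (f := fun t : ℝ => G t)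
    (fun t ht => (hder t ht).continuousAt.continuousWithinAt)
    (fun t ht => (hder t (Ico_subset_Icc_self ht)).hasDerivWithinAt)
  have e1 := hconst x₀ hx₀
  have hl : x₀ - r / 2 ∈ Icc (x₀ - r / 2) (x₀ + r / 2) := ⟨le_rfl, by linarith⟩
  obtain ⟨I, hI⟩ := imagUnits_nonempty
  have := hinj _ (mem_closedBall_self hr.le) _ (ball_subset_closedBall (hdist _ hl)) I hI
    (by rw [e1, evalC, hreal _ (htU _ hl), mul_zero, add_zero])
  have := Complex.ofReal_injective this
  linarith

/-! ### Polar coordinates on the quaternions -/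

lemma piC_eq_mkQ (I : ℍ[ℝ]) (z : ℂ) : piC I z = (z.re : ℍ[ℝ]) + z.im • I := by
  simp [piC, Quaternion.mul_coe_eq_smul]

lemma norm_piC {I : ℍ[ℝ]} (hI : I ∈ imagUnits) (z : ℂ) : ‖piC I z‖ = ‖z‖ := by
  obtain ⟨h0, h1⟩ := mem_imagUnits_iff.1 hI
  rw [← sq_eq_sq₀ (norm_nonneg _) (norm_nonneg _), Complex.sq_norm, Complex.normSq_apply,
    ← real_inner_self_eq_norm_sq, piC_eq_mkQ]
  simp only [inner_eq_sum, Quaternion.re_add, Quaternion.imI_add, Quaternion.imJ_add,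
    Quaternion.imK_add, Quaternion.re_coe, Quaternion.imI_coe, Quaternion.imJ_coe,
    Quaternion.imK_coe, Quaternion.re_smul, Quaternion.imI_smul, Quaternion.imJ_smul,
    Quaternion.imK_smul, h0, smul_eq_mul]
  linear_combination z.im ^ 2 * h1

lemma piC_conj (I : ℍ[ℝ]) (z : ℂ) : piC (-I) (conj z) = piC I z := by
  simp [piC_eq_mkQ]

/-- The imaginary part of a quaternion. -/
def imL : ℍ[ℝ] →L[ℝ] ℍ[ℝ] := LinearMap.toContinuousLinearMap
  { toFun := fun q => mkQ 0 q.imI q.imJ q.imK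
    map_add' := fun x y => by ext <;> simp
    map_smul' := fun r x => by ext <;> simp }

lemma imL_apply (q : ℍ[ℝ]) : imL q = mkQ 0 q.imI q.imJ q.imK := rfl

lemma re_add_imL (q : ℍ[ℝ]) : (q.re : ℍ[ℝ]) + imL q = q := by
  ext <;> simp [imL_apply]

lemma imL_piC {I : ℍ[ℝ]} (hI : I ∈ imagUnits) (z : ℂ) : imL (piC I z) = z.im • I := by
  obtain ⟨h0, -⟩ := mem_imagUnits_iff.1 hI
  ext <;> simp [imL_apply, piC_eq_mkQ, h0]

lemma re_piC {I : ℍ[ℝ]} (hI : I ∈ imagUnits) (z : ℂ) : (piC I z).re = z.re := by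
  obtain ⟨h0, -⟩ := mem_imagUnits_iff.1 hI
  simp [piC_eq_mkQ, h0]

lemma piC_inj {I J : ℍ[ℝ]} (hI : I ∈ imagUnits) (hJ : J ∈ imagUnits) {z w : ℂ}
    (hz : 0 < z.im) (hw : 0 < w.im) (h : piC I z = piC J w) : z = w ∧ I = J := by
  have hre := congrArg (·.re) h
  simp only [re_piC hI, re_piC hJ] at hre
  have him := congrArg imL h
  rw [imL_piC hI, imL_piC hJ] at him
  have hn := congrArg norm him
  rw [norm_smul, norm_smul, norm_of_mem_imagUnits hI, norm_of_mem_imagUnits hJ, mul_one, mul_one,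
    Real.norm_of_nonneg hz.le, Real.norm_of_nonneg hw.le] at hn
  rw [hn] at him
  exact ⟨Complex.ext hre hn, smul_right_injective _ hw.ne' him⟩

/-- The point of the closed upper half plane whose sphere contains `q`. -/
def upper (q : ℍ[ℝ]) : ℂ := ⟨q.re, ‖imL q‖⟩

lemma upper_eq (q : ℍ[ℝ]) : upper q = (q.re : ℂ) + (‖imL q‖ : ℂ) * Complex.I :=
  (Complex.mk_eq_add_mul_I _ _)

lemma exists_piC_upper (q : ℍ[ℝ]) :
    ∃ J ∈ imagUnits, piC J (upper q) = q ∧ ‖imL q‖ • J = imL q := by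
  have key : ∃ J ∈ imagUnits, ‖imL q‖ • J = imL q := by
    by_cases h : imL q = 0
    · obtain ⟨J, hJ⟩ := imagUnits_nonempty
      exact ⟨J, hJ, by simp [h]⟩
    · refine ⟨‖imL q‖⁻¹ • imL q, ?_, smul_inv_smul₀ (norm_ne_zero_iff.2 h) _⟩
      have hn : (inner ℝ (‖imL q‖⁻¹ • imL q) (‖imL q‖⁻¹ • imL q) : ℝ) = 1 := by
        rw [real_inner_self_eq_norm_sq, norm_smul, norm_inv, norm_norm,
          inv_mul_cancel₀ (norm_ne_zero_iff.2 h), one_pow]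
      have h0 : (‖imL q‖⁻¹ • imL q).re = 0 := by simp [imL_apply]
      rw [inner_eq_sum, h0] at hn
      exact mem_imagUnits_iff.2 ⟨h0, by linarith⟩
  obtain ⟨J, hJ, h⟩ := key
  refine ⟨J, hJ, ?_, h⟩
  rw [piC_eq_mkQ, upper, h, re_add_imL]

lemma continuous_upper : Continuous upper := by
  have : upper = fun q => (q.re : ℂ) + (‖imL q‖ : ℂ) * Complex.I := funext upper_eq
  rw [this]
  exact (Complex.continuous_ofReal.comp Quaternion.continuous_re).add
    ((Complex.continuous_ofReal.comp imL.continuous.norm).mul continuous_const)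

lemma upper_piC {I : ℍ[ℝ]} (hI : I ∈ imagUnits) {z : ℂ} (hz : 0 ≤ z.im) :
    upper (piC I z) = z := by
  apply Complex.ext
  · exact re_piC hI z
  · simp only [upper]
    rw [imL_piC hI, norm_smul, norm_of_mem_imagUnits hI, mul_one, Real.norm_of_nonneg hz]

lemma norm_evalC_le {I : ℍ[ℝ]} (hI : I ∈ imagUnits) (w : Fin 4 → ℂ) :
    ‖evalC I w‖ ≤ (‖reQ‖ + ‖imQ‖) * ‖w‖ := by
  refine (norm_add_le _ _).trans ?_
  rw [norm_mul, norm_of_mem_imagUnits hI, one_mul, add_mul]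
  exact add_le_add (reQ.le_opNorm w) (imQ.le_opNorm w)

/-! ### The real differential -/

/-- The differential of a slice function at a real point. -/
lemma hasFDerivAt_of_real {G : ℂ → Fin 4 → ℂ} {f : ℍ[ℝ] → ℍ[ℝ]} {U : Set ℂ} (hU : IsOpen U)
    (hf : ∀ z ∈ U, ∀ I ∈ imagUnits, f (piC I z) = evalC I (G z)) {x₀ : ℝ} (hx : (x₀ : ℂ) ∈ U)
    {G' : Fin 4 → ℂ} (hG : HasDerivAt G G' x₀) (hG' : imQ G' = 0) :
    HasFDerivAt f ((ContinuousLinearMap.mul ℝ ℍ[ℝ]).flip (reQ G')) (x₀ : ℍ[ℝ]) := by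
  have hup : upper (x₀ : ℍ[ℝ]) = x₀ := by
    obtain ⟨I, hI⟩ := imagUnits_nonempty
    have := upper_piC hI (z := (x₀ : ℂ)) (by simp)
    simpa [piC_eq_mkQ] using this
  have ht : Tendsto upper (𝓝 (x₀ : ℍ[ℝ])) (𝓝 (x₀ : ℂ)) := by
    simpa only [hup] using continuous_upper.tendsto (x₀ : ℍ[ℝ])
  have ho := (hasDerivAt_iff_isLittleO.1 hG).comp_tendsto ht
  refine HasFDerivAt.of_isLittleO ?_
  -- `upper` preserves distances to real points, so the little-o estimate for `G` transfers
  -- unchanged.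
  have hnorm : ∀ q : ℍ[ℝ], ‖upper q - x₀‖ = ‖q - x₀‖ := by
    intro q
    obtain ⟨J, hJ, hq, -⟩ := exists_piC_upper q
    rw [← norm_piC hJ, map_sub, hq]
    simp [piC_eq_mkQ]
  refine Asymptotics.IsBigO.trans_isLittleO (Asymptotics.IsBigO.of_bound (‖reQ‖ + ‖imQ‖) ?_)
    (ho.trans_isBigO (Asymptotics.IsBigO.of_bound 1 (Eventually.of_forall fun q => ?_)))
  · filter_upwards [ht (hU.mem_nhds hx)] with q hq
    obtain ⟨J, hJ, hqJ, -⟩ := exists_piC_upper q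
    refine le_trans (le_of_eq ?_) (norm_evalC_le hJ _)
    congr 1
    have e1 := hf _ hq J hJ
    have e2 := hf _ hx J hJ
    rw [hqJ] at e1
    have e3 : piC J (x₀ : ℂ) = x₀ := by simp [piC_eq_mkQ]
    rw [e3] at e2
    have e4 : evalC J G' = reQ G' := by rw [evalC, hG', mul_zero, add_zero]
    simp only [Function.comp_apply, evalC_sub, evalC_smul hJ, ← e1, ← e2, map_sub, hqJ, e3, e4]
    simp [sub_mul]
  · simp [hnorm]

/-- The differential of a slice function at a point off the real axis. -/
lemma hasFDerivAt_of_im_pos {G : ℂ → Fin 4 → ℂ} {f : ℍ[ℝ] → ℍ[ℝ]} {U : Set ℂ} (hU : IsOpen U)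
    (hf : ∀ z ∈ U, ∀ I ∈ imagUnits, f (piC I z) = evalC I (G z)) {z₀ : ℂ} (hz : z₀ ∈ U)
    (hpos : 0 < z₀.im) {I : ℍ[ℝ]} (hI : I ∈ imagUnits)
    {G' : Fin 4 → ℂ} (hG : HasDerivAt G G' z₀) :
    ∃ D : ℍ[ℝ] →L[ℝ] ℍ[ℝ], HasFDerivAt f D (piC I z₀) ∧ ∀ h : ℍ[ℝ],
      D h = piC I ⟨h.re, inner ℝ I h⟩ * evalC I G' +
        (h - piC I ⟨h.re, inner ℝ I h⟩) * (z₀.im⁻¹ • imQ (G z₀)) := by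
  set q₀ := piC I z₀ with hq₀
  have him : imL q₀ = z₀.im • I := imL_piC hI z₀
  have hnorm : ‖imL q₀‖ = z₀.im := by
    rw [him, norm_smul, norm_of_mem_imagUnits hI, mul_one, Real.norm_of_nonneg hpos.le]
  have hup : upper q₀ = z₀ := upper_piC hI hpos.le
  have hn : HasFDerivAt (fun q => ‖imL q‖) (innerSL ℝ I ∘L imL) q₀ := by
    have h1 := (imL.hasFDerivAt (x := q₀)).norm_sq.sqrt (by rw [hnorm]; positivity)
    have h2 : (fun q => √(‖imL q‖ ^ 2)) = fun q => ‖imL q‖ :=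
      funext fun q => Real.sqrt_sq (norm_nonneg _)
    rw [h2] at h1
    refine h1.congr_fderiv ?_
    ext h
    rw [hnorm, Real.sqrt_sq hpos.le, him]
    simp
    field_simp
  let reL : ℍ[ℝ] →L[ℝ] ℝ := LinearMap.toContinuousLinearMap
    { toFun := fun q => q.re, map_add' := fun _ _ => rfl, map_smul' := fun _ _ => rfl }
  have hupd : HasFDerivAt upper (Complex.ofRealCLM ∘L reL +
      (Complex.ofRealCLM ∘L (innerSL ℝ I ∘L imL)).smulRight Complex.I) q₀ := by
    have : upper = fun q => Complex.ofRealCLM (reL q) + Complex.ofRealCLM ‖imL q‖ * Complex.I :=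
      funext upper_eq
    rw [this]
    refine ((Complex.ofRealCLM.hasFDerivAt.comp q₀ reL.hasFDerivAt).add
      ((Complex.ofRealCLM.hasFDerivAt.comp q₀ hn).mul_const Complex.I)).congr_fderiv ?_
    ext1 h
    simp [mul_comm]
  have hGup : HasFDerivAt (fun q => G (upper q)) _ q₀ :=
    HasFDerivAt.comp q₀ (g := G) (by rw [hup]; exact hG.hasFDerivAt.restrictScalars ℝ) hupd
  have hinv := (hasDerivAt_inv (x := ‖imL q₀‖) (by rw [hnorm]; exact hpos.ne')).comp_hasFDerivAt
    q₀ hn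
  have hΨ := (reQ.hasFDerivAt.comp q₀ hGup).add
    ((imL.hasFDerivAt (x := q₀)).mul' (hinv.smul (imQ.hasFDerivAt.comp q₀ hGup)))
  -- Off the real axis the unit of `q` is `Im q / ‖Im q‖`, which makes `f` an explicit smooth
  -- expression in `G ∘ upper`.
  have hev : f =ᶠ[𝓝 q₀] fun q => reQ (G (upper q)) +
      imL q * (‖imL q‖⁻¹ • imQ (G (upper q))) := by
    have ht : Tendsto upper (𝓝 q₀) (𝓝 z₀) := by
      simpa only [hup] using continuous_upper.tendsto q₀
    have hne : ∀ᶠ q in 𝓝 q₀, ‖imL q‖ ≠ 0 :=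
      imL.continuous.norm.continuousAt.eventually_ne (by rw [hnorm]; exact hpos.ne')
    filter_upwards [ht (hU.mem_nhds hz), hne] with q hq hqne
    obtain ⟨J, hJ, hqJ, hqI⟩ := exists_piC_upper q
    have e1 := hf _ hq J hJ
    rw [hqJ] at e1
    rw [e1, evalC, ← hqI, norm_smul, norm_of_mem_imagUnits hJ, mul_one, norm_norm,
      smul_mul_smul_comm, mul_inv_cancel₀ hqne, one_smul]
  refine ⟨_, hΨ.congr_of_eventuallyEq hev, fun h => ?_⟩
  have hinner : (inner ℝ I (imL h) : ℝ) = inner ℝ I h := by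
    obtain ⟨h0, -⟩ := mem_imagUnits_iff.1 hI
    simp [inner_eq_sum, imL_apply, h0]
  have hsub : h - piC I ⟨h.re, inner ℝ I h⟩ = imL h - (inner ℝ I h : ℝ) • I := by
    rw [piC_eq_mkQ]
    nth_rewrite 1 [← re_add_imL h]
    abel
  have hζ : (⟨h.re, inner ℝ I h⟩ : ℂ) = (h.re : ℂ) + ((inner ℝ I h : ℝ) : ℂ) * Complex.I :=
    Complex.mk_eq_add_mul_I _ _
  rw [hsub, ← evalC_smul hI, hζ]
  -- The product rule, unfolded. The derivative of `‖Im q‖⁻¹` contributes the term that removes from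
  -- `Im h` its component along `I`.
  change reQ (((h.re : ℂ) + (inner ℝ I (imL h) : ℝ) • Complex.I) • G') +
    (imL q₀ * (‖imL q₀‖⁻¹ • imQ (((h.re : ℂ) + (inner ℝ I (imL h) : ℝ) • Complex.I) • G') +
      (-(‖imL q₀‖ ^ 2)⁻¹ * inner ℝ I (imL h)) • imQ (G (upper q₀))) +
      imL h * (‖imL q₀‖⁻¹ • imQ (G (upper q₀)))) = _
  rw [hnorm, hup, hinner, him, Complex.real_smul, evalC]
  generalize imQ (((h.re : ℂ) + ((inner ℝ I h : ℝ) : ℂ) * Complex.I) • G') = a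
  have e1 : (z₀.im • I) * (z₀.im⁻¹ • a) = I * a := by
    rw [smul_mul_smul_comm, mul_inv_cancel₀ hpos.ne', one_smul]
  have e2 : z₀.im * (-(z₀.im ^ 2)⁻¹ * inner ℝ I h) = -(inner ℝ I h * z₀.im⁻¹) := by
    field_simp
  rw [mul_add, e1, smul_mul_smul_comm, e2, sub_mul, smul_mul_smul_comm, neg_smul]
  abel

/-! ### Triviality of the kernel -/

/-- Since `η` is orthogonal to the plane `ℂ_I`, `ζ A = -η s` is orthogonal to `ℂ_I s`, in particular
to `ζ s` and `ζ I s`. Cancelling the left factor `ζ` costs only `‖ζ‖²`. -/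
lemma inner_eq_zero_of_piC_mul_add_mul_eq_zero {I : ℍ[ℝ]} (hI : I ∈ imagUnits) {ζ : ℂ}
    (hζ : ζ ≠ 0) {η A s : ℍ[ℝ]} (h₁ : η.re = 0) (hηI : inner ℝ η I = (0 : ℝ))
    (h : piC I ζ * A + η * s = 0) :
    inner ℝ A s = (0 : ℝ) ∧ inner ℝ A (I * s) = (0 : ℝ) := by
  have hA : piC I ζ * A = -(η * s) := eq_neg_of_add_eq_zero_left h
  have hne : inner ℝ (piC I ζ) (piC I ζ) ≠ (0 : ℝ) := by
    rw [inner_self_eq_zero.ne, ← norm_ne_zero_iff, norm_piC hI]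
    exact norm_ne_zero_iff.2 hζ
  have horth : ∀ w : ℂ, inner ℝ η (piC I w) = (0 : ℝ) := by
    intro w
    rw [piC_eq_mkQ, inner_add_right, inner_smul_right, hηI, mul_zero, add_zero, inner_eq_sum, h₁]
    simp
  have key : ∀ w : ℂ, inner ℝ (piC I ζ * A) (piC I w * s) = (0 : ℝ) := by
    intro w
    rw [hA, inner_neg_left, inner_mul_right_mul_right, horth, mul_zero, neg_zero]
  have hmulI : piC I (ζ * Complex.I) = piC I ζ * I := by
    simp only [piC_eq_mkQ, Complex.mul_re, Complex.mul_im, Complex.I_re, Complex.I_im, mul_zero,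
      mul_one, zero_sub, add_zero, add_mul, smul_mul_assoc,
      mul_self_of_mem_imagUnits hI, Quaternion.coe_mul_eq_smul, smul_neg]
    rw [add_comm]
    congr 1
    ext <;> simp
  constructor
  · have := key ζ
    rw [inner_mul_left_mul_left] at this
    exact (mul_eq_zero.1 this).resolve_left hne
  · have := key (ζ * Complex.I)
    rw [hmulI, mul_assoc, inner_mul_left_mul_left] at this
    exact (mul_eq_zero.1 this).resolve_left hne

lemma isInvertible_of_forall_eq_zero {E : Type*} [NormedAddCommGroup E] [NormedSpace ℝ E]
    [FiniteDimensional ℝ E] {D : E →L[ℝ] E} (h : ∀ x, D x = 0 → x = 0) : D.IsInvertible := by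
  have hinj : Function.Injective (D : E →ₗ[ℝ] E) := (injective_iff_map_eq_zero _).2 h
  exact ⟨(LinearEquiv.ofInjectiveEndo _ hinj).toContinuousLinearEquiv, by ext; rfl⟩

lemma isInvertible_fderiv_of_real {G : ℂ → Fin 4 → ℂ} {f : ℍ[ℝ] → ℍ[ℝ]} {U : Set ℂ}
    (hU : IsOpen U) (hG : DifferentiableOn ℂ G U)
    (hf : ∀ z ∈ U, ∀ I ∈ imagUnits, f (piC I z) = evalC I (G z))
    (hinj : InjOn f (circularSet U)) (hreal : ∀ t : ℝ, (t : ℂ) ∈ U → imQ (G t) = 0)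
    {x₀ : ℝ} (hx : (x₀ : ℂ) ∈ U) :
    DifferentiableAt ℝ f x₀ ∧ (fderiv ℝ f x₀).IsInvertible := by
  -- Differentiate `Im G = 0` along the real axis.
  have hreal' : ∀ t : ℝ, (t : ℂ) ∈ U → imQ (deriv G t) = 0 := by
    intro t ht
    have h1 := ((hG.differentiableAt (hU.mem_nhds ht)).hasDerivAt).scomp t
      Complex.ofRealCLM.hasDerivAt
    have h2 := (imQ.hasFDerivAt (x := G t)).comp_hasDerivAt t h1
    have h3 : HasDerivAt (imQ ∘ (G ∘ Complex.ofRealCLM)) 0 t := by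
      refine (hasDerivAt_const t (0 : ℍ[ℝ])).congr_of_eventuallyEq ?_
      filter_upwards [(Complex.continuous_ofReal.tendsto t) (hU.mem_nhds ht)] with u hu
      exact hreal u hu
    simpa using h2.unique h3
  obtain ⟨r, hr, hrU⟩ := nhds_basis_closedBall.mem_iff.1 (hU.mem_nhds hx)
  have hne : deriv G x₀ ≠ 0 := by
    refine deriv_ne_zero_of_real hU hG hr hrU hreal hreal' fun z hz t ht I hI h => ?_
    have h1 : evalC I (G t) = reQ (G t) := by rw [evalC, hreal t (hrU ht), mul_zero, add_zero]
    rw [← h1, ← hf z (hrU hz) I hI, ← hf t (hrU ht) I hI] at h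
    have h2 := hinj ⟨z, hrU hz, I, hI, rfl⟩ ⟨t, hrU ht, I, hI, rfl⟩ h
    rw [← sub_eq_zero, ← norm_eq_zero, ← norm_piC hI, map_sub, h2, sub_self, norm_zero]
  have hA : reQ (deriv G x₀) ≠ 0 := fun h =>
    hne (ext_reQ_imQ (by rw [h, map_zero]) (by rw [hreal' _ hx, map_zero]))
  have hD := hasFDerivAt_of_real hU hf hx
    (hG.differentiableAt (hU.mem_nhds hx)).hasDerivAt (hreal' _ hx)
  refine ⟨hD.differentiableAt, ?_⟩
  rw [hD.fderiv]
  refine isInvertible_of_forall_eq_zero fun h h0 => ?_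
  exact (mul_eq_zero.1 (show h * reQ (deriv G x₀) = 0 from h0)).resolve_right hA

lemma isInvertible_fderiv_of_im_pos {G : ℂ → Fin 4 → ℂ} {f : ℍ[ℝ] → ℍ[ℝ]} {U : Set ℂ}
    (hU : IsOpen U) (hG : DifferentiableOn ℂ G U)
    (hf : ∀ z ∈ U, ∀ I ∈ imagUnits, f (piC I z) = evalC I (G z))
    (hinj : InjOn f (circularSet U)) {z₀ : ℂ} (hz : z₀ ∈ U) (hpos : 0 < z₀.im)
    {I : ℍ[ℝ]} (hI : I ∈ imagUnits) :
    DifferentiableAt ℝ f (piC I z₀) ∧ (fderiv ℝ f (piC I z₀)).IsInvertible := by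
  have hinj' : ∀ z ∈ U ∩ {z | 0 < z.im}, ∀ z' ∈ U ∩ {z | 0 < z.im}, ∀ I ∈ imagUnits,
      ∀ J ∈ imagUnits, evalC I (G z) = evalC J (G z') → z = z' ∧ I = J := by
    intro z hz z' hz' I hI J hJ h
    rw [← hf z hz.1 I hI, ← hf z' hz'.1 J hJ] at h
    exact piC_inj hI hJ hz.2 hz'.2 (hinj ⟨z, hz.1, I, hI, rfl⟩ ⟨z', hz'.1, J, hJ, rfl⟩ h)
  have hopen : IsOpen (U ∩ {z | 0 < z.im}) :=
    hU.inter (isOpen_lt continuous_const Complex.continuous_im)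
  have hz' : z₀ ∈ U ∩ {z | 0 < z.im} := ⟨hz, hpos⟩
  obtain ⟨r, hr, hrU⟩ := nhds_basis_closedBall.mem_iff.1 (hopen.mem_nhds hz')
  have hne := dotProduct_deriv_ne_zero hU hG hr (hrU.trans inter_subset_left)
    (fun z hz z' hz' => hinj' z (hrU hz) z' (hrU hz')) hI
  have hs : imQ (G z₀) ≠ 0 := fun hs => ne_neg_of_mem_imagUnits hI
    (hinj' z₀ hz' z₀ hz' I hI (-I) (neg_mem_imagUnits hI) (by simp [evalC, hs])).2
  obtain ⟨D, hD, hDh⟩ := hasFDerivAt_of_im_pos hU hf hz hpos hI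
    (hG.differentiableAt (hU.mem_nhds hz)).hasDerivAt
  refine ⟨hD.differentiableAt, ?_⟩
  rw [hD.fderiv]
  refine isInvertible_of_forall_eq_zero fun h h0 => ?_
  rw [hDh, mul_smul_comm, ← smul_mul_assoc] at h0
  -- This complex number is the component of `h` in the plane `ℂ_I`.
  by_cases hζ : (⟨h.re, inner ℝ I h⟩ : ℂ) = 0
  · rw [hζ, map_zero, zero_mul, sub_zero, zero_add] at h0
    exact (smul_eq_zero.1 ((mul_eq_zero.1 h0).resolve_right hs)).resolve_left
      (inv_ne_zero hpos.ne')
  · exfalso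
    have hII : inner ℝ I I = (1 : ℝ) := by
      rw [real_inner_self_eq_norm_sq, norm_of_mem_imagUnits hI, one_pow]
    obtain ⟨hI0, -⟩ := mem_imagUnits_iff.1 hI
    have hcoe : inner ℝ I ((h.re : ℝ) : ℍ[ℝ]) = (0 : ℝ) := by simp [inner_eq_sum, hI0]
    have h1 : (z₀.im⁻¹ • (h - piC I ⟨h.re, inner ℝ I h⟩)).re = 0 := by
      simp [re_piC hI]
    have h2 : inner ℝ (z₀.im⁻¹ • (h - piC I ⟨h.re, inner ℝ I h⟩)) I = (0 : ℝ) := by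
      rw [real_inner_comm, inner_smul_right, inner_sub_right, piC_eq_mkQ, inner_add_right,
        inner_smul_right, hII, hcoe]
      simp
    obtain ⟨k1, k2⟩ := inner_eq_zero_of_piC_mul_add_mul_eq_zero hI hζ h1 h2 h0
    apply hne
    rw [dotProduct_of_evalC_eq_zero hI (by rw [evalC_sub, evalC_vecQ, sub_self]), map_sub,
      imQ_vecQ, sub_zero, k1, k2, neg_zero]
    rfl

/-! ### Conclusion -/

/-- An injective slice regular function is real differentiable with invertible differential. -/
theorem isInvertible_fderiv_of_injOn (𝒰 : Set ℂ) (h𝒰 : IsOpen 𝒰) (f : ℍ[ℝ] → ℍ[ℝ])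
    (hf : IsSliceRegularOn 𝒰 f)
    (hinj : Set.InjOn f (circularSet 𝒰)) :
    ∀ q ∈ circularSet 𝒰,
      DifferentiableAt ℝ f q ∧ (fderiv ℝ f q).IsInvertible := by
  obtain ⟨F, hstem, hhol, hind⟩ := hf
  have hf' : ∀ z ∈ 𝒰, ∀ I ∈ imagUnits, f (piC I z) = evalC I (toC4 (F z)) := fun z hz I hI => by
    rw [hind z hz I hI, evalC_toC4 hI]
  have hreal : ∀ t : ℝ, (t : ℂ) ∈ 𝒰 → imQ (toC4 (F t)) = 0 := by
    intro t ht
    have h := (hstem t ht).2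
    rw [Complex.conj_ofReal] at h
    have h1 := (toC4_conjT (F t)).2
    rw [← h] at h1
    have h2 : (2 : ℝ) • imQ (toC4 (F t)) = 0 := by
      rw [two_smul]
      exact add_eq_zero_iff_eq_neg.2 h1
    exact (smul_eq_zero.1 h2).resolve_left two_ne_zero
  rintro q ⟨z, hz, I, hI, rfl⟩
  rcases lt_trichotomy z.im 0 with h | h | h
  -- The pairs `(z, I)` and `(conj z, -I)` give the same quaternion, so the lower half plane reduces
  -- to the upper one.
  · rw [← piC_conj]
    exact isInvertible_fderiv_of_im_pos h𝒰 hhol hf' hinj (hstem z hz).1 (by simpa using h)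
      (neg_mem_imagUnits hI)
  · have hzr : z = (z.re : ℂ) := Complex.ext (by simp) (by simp [h])
    have hp : piC I z = ((z.re : ℝ) : ℍ[ℝ]) := by simp [piC_eq_mkQ, h]
    rw [hp]
    rw [hzr] at hz
    exact isInvertible_fderiv_of_real h𝒰 hhol hf' hinj hreal hz
  · exact isInvertible_fderiv_of_im_pos h𝒰 hhol hf' hinj hz h hI

end SliceRegular

end

theorem mainTheorem5 (𝒰 : Set ℂ) (h𝒰 : IsOpen 𝒰) (f : ℍ[ℝ] → ℍ[ℝ])
    (hf : SliceRegular.IsSliceRegularOn 𝒰 f)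
    (hinj : Set.InjOn f (SliceRegular.circularSet 𝒰)) :
    ∀ q ∈ SliceRegular.circularSet 𝒰,
      DifferentiableAt ℝ f q ∧ (fderiv ℝ f q).IsInvertible :=
  SliceRegular.isInvertible_fderiv_of_injOn 𝒰 h𝒰 f hf hinj
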